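/- **The Column Lemma.** Fix $n\ge 0$, a permutation $\sigma$ of $[n]=\{1,\dots,n\}$ (whose elements are called colours), an integer $m\ge 0$, a commutative ring and an element $x_c$ of it (for instance a variable of a polynomial ring). *Labels.* The edge labels are $0$, $+$, and, for colours $b,f,g\in[n]$, the labels $b$, $b^+$, $fg$, $fg^+$. *Tiles.* All tiles are unit rhombi with labelled edges. Right-sheared tiles have two horizontal edges and two edges of direction $/$; left-sheared tiles have two horizontal edges and two edges of direction $\backslash$; both are written $(\text{left},\text{bottom},\text{right},\text{top})$. Diamond tiles have edges of directions $/$ (NW and SE) and $\backslash$ (SW and NE). Below $f,g,i,j$ range over $[n]$ with $i\le j$ and $\sigma(f)<\sigma(g)$. - Right-sheared tiles of weight $1$: $(0,0,0,0)$, $(i,i,0,0)$, $(0,0,i,i)$, $(j,j,i,i)$, $(g,f,g,f)$, $(0,+,0,+)$, $(i,+,i,+)$, $(i^+,i,0,+)$, $(0,+,i^+,i)$, $(j^+,j,i^+,i)$, $(g^+,f,g^+,f)$. Right-sheared tiles of weight $x_c$: $(0,i,0,i)$. - Left-sheared tiles of weight $1$: $(0,0,0,0)$, $(0,i,0,i)$,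 $(+,i,+,i)$, $(+,0,0,+)$, $(0,+,+,0)$, $(+,+,+,+)$, $(i^+,i,0,+)$, $(0,+,i^+,i)$. Left-sheared tile of weight $-x_c$: $(0,+,0,+)$. - Diamond tiles, all of weight $1$: let $T$ be the set of triples $(0,0,0)$, $(i,i,0)$, $(i^+,i,+)$, $(0,+,+)$, $(i,+,i^+)$, $(g,f,fg)$, $(g^+,f,fg^+)$ (the labels on the edges of directions $/$, horizontal, $\backslash$ of the unit triangles into which the right-sheared tiles of weight $1$ are cut by their short diagonals). A diamond with labels $\mathrm{SW},\mathrm{SE},\mathrm{NW},\mathrm{NE}$ is a tile if and only if there is a label $h$ with $(\mathrm{NW},h,\mathrm{NE})\in T$ and $(\mathrm{SE},h,\mathrm{SW})\in T$. *Banned adjacencies.* If the NE edge of a diamond $A$ is the SW edge of a diamond $B$, with common label $e$, then for colours $i<j$ it is forbidden that $(\mathrm{NW}(A),e,\mathrm{SE}(B))$ equals $(i,0,j)$ or $(i^+,+,j^+)$. There is no such restriction between tiles that are not both diamonds. *Columns.* Consider the hexagon with horizontal sides of length $1$, sides of direction $/$ of length $m$ and sides of direction $\backslash$ of length $1$. Fix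 labels on its boundary: $s$ on the bottom, $r$ on the SW side, $q_1,\dots,q_m$ on the NW side (from bottom to top), $v$ on the top, $u$ on the NE side, and $t_1,\dots,t_m$ on the SE side (from bottom to top). Cut it into rhombi in two ways: - (left-hand side) a left-sheared tile at the bottom, having the boundary edges $r$ and $s$; on top of it a column of $m$ right-sheared tiles with left edges $q_1,\dots,q_m$ and top edge $v$; and to the right of both a strip of $m$ diamonds with SE edges $t_1,\dots,t_m$ and last NE edge $u$; - (right-hand side) a strip of $m$ diamonds on the left, with first SW edge $r$ and NW edges $q_1,\dots,q_m$; to its right a column of $m$ right-sheared tiles with bottom edge $s$ and right edges $t_1,\dots,t_m$; and on top of both a left-sheared tile having the boundary edges $u$ and $v$. The partition function of either side is the sum, over all ways of placing tiles of the corresponding shapes such that labels agree along common edges and with the boundary and no banned adjacency occurs, of the product of the tile weights. **Claim.** For all labels $q_1,\dots,q_m,r,s,t_1,\dots,t_m,u,v$ with $r,u\in\{0,+\}$, the partition functions of the two sides are equal. -/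

import Mathlib

/-- Edge labels. Colours `1, …, n` are represented by `Fin n`.
`zero` is the empty edge, `plus` is a red line, `blue b` is a blue line of colour `b`,
`bluePlus b` (written `b⁺`) is a blue line `b` and a red line sharing the edge, `cross f g`
(written `fg`) is two blue lines `f`, `g` sharing the edge, and `crossPlus f g` (written `fg⁺`)
is two blue lines and a red line sharing the edge. -/
inductive Label (n : ℕ) : Type
  | zero : Label n
  | plus : Label n
  | blue (b : Fin n) : Label n
  | bluePlus (b : Fin n) : Label n
  | cross (f g : Fin n) : Label n
  | crossPlus (f g : Fin n) : Label n
  deriving DecidableEq, Fintype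

namespace Label

/-- The trivial right-sheared tiles, as `RightTrivial σ left bottom right top`.
A right-sheared tile is a unit rhombus with two horizontal edges and two edges of direction `/`.
Blue lines enter at the bottom or the right and leave at the left or the top. -/
inductive RightTrivial {n : ℕ} (σ : Equiv.Perm (Fin n)) :
    Label n → Label n → Label n → Label n → Prop
  | empty : RightTrivial σ zero zero zero zero
  | turnLeft (i : Fin n) : RightTrivial σ (blue i) (blue i) zero zero
  | turnUp (i : Fin n) : RightTrivial σ zero zero (blue i) (blue i)
  | turnBoth (i j : Fin n) (h : i ≤ j) : RightTrivial σ (blue j) (blue j) (blue i) (blue i)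
  | cross (f g : Fin n) (h : σ f < σ g) : RightTrivial σ (blue g) (blue f) (blue g) (blue f)
  | red : RightTrivial σ zero plus zero plus
  | redCross (i : Fin n) : RightTrivial σ (blue i) plus (blue i) plus
  | turnLeftPlus (i : Fin n) : RightTrivial σ (bluePlus i) (blue i) zero plus
  | turnUpPlus (i : Fin n) : RightTrivial σ zero plus (bluePlus i) (blue i)
  | turnBothPlus (i j : Fin n) (h : i ≤ j) :
      RightTrivial σ (bluePlus j) (blue j) (bluePlus i) (blue i)
  | crossPlus (f g : Fin n) (h : σ f < σ g) :
      RightTrivial σ (bluePlus g) (blue f) (bluePlus g) (blue f)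

/-- The nontrivial right-sheared tiles (`left bottom right top`), of weight `x_c`: a blue line goes
straight from the bottom to the top. -/
inductive RightNontrivial {n : ℕ} : Label n → Label n → Label n → Label n → Prop
  | vertical (i : Fin n) : RightNontrivial zero (blue i) zero (blue i)

/-- The trivial left-sheared tiles, as `LeftTrivial left bottom right top`.
A left-sheared tile is a unit rhombus with two horizontal edges and two edges of direction `\`.
Here blue lines never cross each other. -/
inductive LeftTrivial {n : ℕ} : Label n → Label n → Label n → Label n → Prop
  | empty : LeftTrivial zero zero zero zero
  | blueUp (i : Fin n) : LeftTrivial zero (blue i) zero (blue i)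
  | blueUpRedRight (i : Fin n) : LeftTrivial plus (blue i) plus (blue i)
  | redTurnUp : LeftTrivial plus zero zero plus
  | redTurnRight : LeftTrivial zero plus plus zero
  | redTurnBoth : LeftTrivial plus plus plus plus
  | blueTurnLeft (i : Fin n) : LeftTrivial (bluePlus i) (blue i) zero plus
  | blueTurnUp (i : Fin n) : LeftTrivial zero plus (bluePlus i) (blue i)

/-- The nontrivial left-sheared tile (`left bottom right top`), of weight `-x_c`: a red line goes
straight from the bottom to the top. -/
inductive LeftNontrivial {n : ℕ} : Label n → Label n → Label n → Label n → Prop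
  | vertical : LeftNontrivial zero plus zero plus

/-- The unit triangles obtained by cutting the trivial right-sheared tiles along their short
diagonal (of direction `\`), as `Triangle σ a h d`, where `a`, `h`, `d` are the labels of the edges
of direction `/`, `—`, `\`. The lower left half of a tile is an upward triangle
(`a` left, `h` bottom, `d` right); the upper right half is a downward triangle
(`a` right, `h` top, `d` left). The same labels are allowed for both. -/
inductive Triangle {n : ℕ} (σ : Equiv.Perm (Fin n)) : Label n → Label n → Label n → Prop
  | empty : Triangle σ zero zero zero
  | blue (i : Fin n) : Triangle σ (blue i) (blue i) zero
  | bluePlus (i : Fin n) : Triangle σ (bluePlus i) (blue i) plus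
  | red : Triangle σ zero plus plus
  | redCross (i : Fin n) : Triangle σ (blue i) plus (bluePlus i)
  | cross (f g : Fin n) (h : σ f < σ g) : Triangle σ (blue g) (blue f) (cross f g)
  | crossPlus (f g : Fin n) (h : σ f < σ g) : Triangle σ (bluePlus g) (blue f) (crossPlus f g)

/-- The diamond tiles (all of weight `1`), as `Diamond σ sw se nw ne`: unit rhombi with edges of
directions `\` (south-west and north-east) and `/` (south-east and north-west). They are all the
gluings of an upward triangle on top of a downward triangle along a horizontal edge. -/
def Diamond {n : ℕ} (σ : Equiv.Perm (Fin n)) (sw se nw ne : Label n) : Prop :=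
  ∃ h : Label n, Triangle σ nw h ne ∧ Triangle σ se h sw

/-- The banned adjacencies of two diamonds, the north-east edge of the lower one being the
south-west edge of the upper one. `Banned nw e se`: `nw` is the north-west label of the lower
diamond, `e` the label of the common edge, `se` the south-east label of the upper diamond. A blue
line `i` must not move diagonally directly below a blue line `j` if `i < j`. -/
inductive Banned {n : ℕ} : Label n → Label n → Label n → Prop
  | blue (i j : Fin n) (h : i < j) : Banned (blue i) zero (blue j)
  | bluePlus (i j : Fin n) (h : i < j) : Banned (bluePlus i) plus (bluePlus j)

/-- A legal strip of `m` diamonds going to the north-east: the `k`-th one, counted from the bottom,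
has labels `e k` (SW), `se k` (SE), `nw k` (NW), `e (k + 1)` (NE). -/
def DiamondStrip {n m : ℕ} (σ : Equiv.Perm (Fin n)) (e : Fin (m + 1) → Label n)
    (se nw : Fin m → Label n) : Prop :=
  (∀ k : Fin m, Diamond σ (e k.castSucc) (se k) (nw k) (e k.succ)) ∧
    ∀ k l : Fin m, (l : ℕ) = k + 1 → ¬ Banned (nw k) (e k.succ) (se l)

end Label

open Classical in
/-- Weight of a right-sheared tile with the given labels; `0` if there is no such tile. -/
noncomputable def rightWeight {n : ℕ} {R : Type*} [CommRing R] (σ : Equiv.Perm (Fin n)) (x : R)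
    (left bottom right top : Label n) : R :=
  if Label.RightTrivial σ left bottom right top then 1
  else if Label.RightNontrivial left bottom right top then x
  else 0

open Classical in
/-- Weight of a left-sheared tile with the given labels; `0` if there is no such tile. -/
noncomputable def leftWeight {n : ℕ} {R : Type*} [CommRing R] (x : R)
    (left bottom right top : Label n) : R :=
  if Label.LeftTrivial left bottom right top then 1
  else if Label.LeftNontrivial left bottom right top then -x
  else 0

open Classical in
/-- Weight of a strip of diamonds: `1` if it is legal, `0` otherwise. -/
noncomputable def stripWeight {n m : ℕ} (R : Type*) [CommRing R] (σ : Equiv.Perm (Fin n))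
    (e : Fin (m + 1) → Label n) (se nw : Fin m → Label n) : R :=
  if Label.DiamondStrip σ e se nw then 1 else 0

/-- Partition function of the first tiling of the elongated hexagon whose boundary reads, clockwise
from the bottom edge: `s` (bottom), `r` (SW, direction `\`), `q 0, …, q (m-1)` (NW, direction `/`,
upwards), `v` (top), `u` (NE, direction `\`), and whose SE side, of direction `/`, reads upwards
`t 0, …, t (m-1)`.

A left-sheared tile sits at the bottom (left `r`, bottom `s`), a column of `m` right-sheared tiles
on top of it (left sides `q`, last top `v`), and a strip of `m` diamonds to the right of both
(SE sides `t`, last NE `u`). A tiling is given by the labels of the internal edges: `h` on the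
horizontal edges of the column (`h m = v`), `e` on the edges of direction `\` of the strip
(`e m = u`), and `w` on the edges between the column and the strip. -/
noncomputable def columnLHS {n m : ℕ} {R : Type*} [CommRing R] (σ : Equiv.Perm (Fin n)) (x : R)
    (q : Fin m → Label n) (r s : Label n) (t : Fin m → Label n) (u v : Label n) : R :=
  ∑ h : Fin (m + 1) → Label n, ∑ e : Fin (m + 1) → Label n, ∑ w : Fin m → Label n,
    if h (Fin.last m) = v ∧ e (Fin.last m) = u then
      leftWeight x r s (e 0) (h 0) *
        (∏ k : Fin m, rightWeight σ x (q k) (h k.castSucc) (w k) (h k.succ)) *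
        stripWeight R σ e t w
    else 0

/-- Partition function of the second tiling of the same hexagon: a strip of `m` diamonds on the left
(first SW `r`, NW sides `q`), a column of `m` right-sheared tiles to its right (first bottom `s`,
right sides `t`), and a left-sheared tile on top of both (right `u`, top `v`). -/
noncomputable def columnRHS {n m : ℕ} {R : Type*} [CommRing R] (σ : Equiv.Perm (Fin n)) (x : R)
    (q : Fin m → Label n) (r s : Label n) (t : Fin m → Label n) (u v : Label n) : R :=
  ∑ h : Fin (m + 1) → Label n, ∑ e : Fin (m + 1) → Label n, ∑ w : Fin m → Label n,
    if h 0 = s ∧ e 0 = r then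
      stripWeight R σ e w q *
        (∏ k : Fin m, rightWeight σ x (w k) (h k.castSucc) (t k) (h k.succ)) *
        leftWeight x (e (Fin.last m)) (h (Fin.last m)) u v
    else 0

/-!
Cut every diamond of a strip along its horizontal diagonal. The upper half of one diamond and the
lower half of the next one glue to a right-sheared tile of weight parameter `0`, and the banned
adjacencies are exactly what makes this gluing bijective. Hence both sides of the lemma become two
adjacent columns of right-sheared tiles, with parameters `x, 0` on the left-hand side and `0, x` on
the right-hand side, closed at both ends by the left-sheared tile and a half diamond.

A row of two such columns is a transfer matrix on pairs of horizontal edges, and a single operator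
`exchange` intertwines the two orders of the parameters (a Yang–Baxter equation, which for two
crossing blue lines is a braid relation). Moving `exchange` through all the rows leaves one
identity at either end of the column, and these only use that the end labels are `0` or `+`.
-/

open Matrix

section Paths

variable {k : ℕ} {α : Type*} [Fintype α]

theorem sum_fin_cons {M : Type*} [AddCommMonoid M] (F : (Fin (k + 1) → α) → M) :
    ∑ p, F p = ∑ p : Fin k → α, ∑ a, F (Fin.cons a p) := by
  rw [← (Fin.consEquiv fun _ => α).sum_comp, Fintype.sum_prod_type_right]
  rfl

theorem sum_fin_snoc {M : Type*} [AddCommMonoid M] (F : (Fin (k + 1) → α) → M) :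
    ∑ p, F p = ∑ p : Fin k → α, ∑ a, F (Fin.snoc p a) := by
  rw [← (Fin.snocEquiv fun _ => α).sum_comp, Fintype.sum_prod_type_right]
  rfl

variable {R : Type*} [CommSemiring R]

theorem sum_mul_prod_mul_eq_mul_prod_mul (f g : α → R) (M : Fin k → α → R) :
    ∑ e : Fin (k + 2) → α, f (e 0) * (∏ i : Fin k, M i (e i.castSucc.succ)) * g (e (Fin.last _)) =
      (∑ a, f a) * (∏ i, ∑ a, M i a) * ∑ a, g a := by
  classical
  have expand := Fintype.prod_sum (Fin.cons f (Fin.snoc M g) : Fin (k + 2) → α → R)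
  simpa [Fin.prod_univ_succ (n := k + 1), Fin.prod_univ_castSucc, mul_assoc, eq_comm] using expand

theorem sum_path_eq_dotProduct [DecidableEq α] (f g : α → R) (M : Fin k → Matrix α α R) :
    ∑ p : Fin (k + 1) → α, f (p 0) * (∏ i, M i (p i.castSucc) (p i.succ)) * g (p (Fin.last k)) =
      f ⬝ᵥ (List.ofFn M).prod *ᵥ g := by
  induction k generalizing f with
  | zero => simp [← (Equiv.funUnique (Fin 1) α).symm.sum_comp, dotProduct]
  | succ k ih =>
    simp only [List.ofFn_succ, List.prod_cons, ← mulVec_mulVec, dotProduct_mulVec f, ← ih,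
      ← (Fin.consEquiv fun _ => α).sum_comp, Fintype.sum_prod_type_right, Fin.prod_univ_succ]
    simp [vecMul, dotProduct, Finset.sum_mul, mul_assoc]

theorem list_prod_mulVec_comm [DecidableEq α] (E : (α → R) → α → R) (A B : Fin k → Matrix α α R)
    (comm : ∀ i F, A i *ᵥ E F = E (B i *ᵥ F)) (F : α → R) :
    (List.ofFn A).prod *ᵥ E F = E ((List.ofFn B).prod *ᵥ F) := by
  induction k with
  | zero => simp
  | succ k ih => simp [← mulVec_mulVec, ih _ _ fun i => comm i.succ, comm]

end Paths

namespace Label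

section ColourExchange

variable {α β M : Type*} [LinearOrder α] [LinearOrder β] (σ : α → β)

/-- The action on functions `G` of the colours of two horizontal edges, read from left to right,
of a pair of blue lines which may exchange their colours: `G k f` is the term with the colours
exchanged. The first condition lets the lines touch, the second one lets them cross. -/
def colourExchange [AddZeroClass M] (G : α → α → M) (f k : α) : M :=
  (if k ≤ f then G f k else 0) + if σ f < σ k then G k f else 0

theorem colourExchange_ite [AddZeroClass M] (p : Prop) [Decidable p] (G : α → α → M) (f k : α) :
    colourExchange σ (fun f k => if p then G f k else 0) f k =
      if p then colourExchange σ G f k else 0 := by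
  split_ifs <;> simp [colourExchange]

theorem colourExchange_braid [AddCommGroup M] (G : α → α → α → M) (f k l : α) :
    colourExchange σ (fun f k => colourExchange σ
      (fun k l => colourExchange σ (fun f k => G f k l) f k) k l) f k =
    colourExchange σ (fun k l => colourExchange σ
      (fun f k => colourExchange σ (fun k l => G f k l) k l) f k) k l := by
  unfold colourExchange
  grind

end ColourExchange

section Tiles

variable {n : ℕ} {R : Type*} [CommRing R] (σ : Equiv.Perm (Fin n)) (x y : R)

theorem sum_univ {M : Type*} [AddCommMonoid M] (F : Label n → M) :
    ∑ l, F l = F zero + F plus + ∑ i, F (blue i) + ∑ i, F (bluePlus i) +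
      ∑ f, ∑ g, F (cross f g) + ∑ f, ∑ g, F (crossPlus f g) := by
  let e : Label n ≃
      Unit ⊕ Unit ⊕ Fin n ⊕ Fin n ⊕ (Fin n × Fin n) ⊕ (Fin n × Fin n) :=
    { toFun := fun
        | zero => .inl ()
        | plus => .inr (.inl ())
        | blue i => .inr (.inr (.inl i))
        | bluePlus i => .inr (.inr (.inr (.inl i)))
        | cross f g => .inr (.inr (.inr (.inr (.inl (f, g)))))
        | crossPlus f g => .inr (.inr (.inr (.inr (.inr (f, g)))))
      invFun := fun
        | .inl _ => zero
        | .inr (.inl _) => plus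
        | .inr (.inr (.inl i)) => blue i
        | .inr (.inr (.inr (.inl i))) => bluePlus i
        | .inr (.inr (.inr (.inr (.inl (f, g))))) => cross f g
        | .inr (.inr (.inr (.inr (.inr (f, g))))) => crossPlus f g
      left_inv := by rintro ⟨⟩ <;> rfl
      right_inv := by rintro (_ | _ | _ | _ | _ | _) <;> rfl }
  simp [← e.symm.sum_comp, e, Fintype.sum_sum_type, Fintype.sum_prod_type, add_assoc]

theorem rightWeight_eq (l b r t : Label n) : rightWeight σ x l b r t =
    match l, b, r, t with
    | zero, zero, zero, zero => 1
    | zero, zero, blue i, blue k => if i = k then 1 else 0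
    | zero, plus, zero, plus => 1
    | zero, plus, bluePlus i, blue k => if i = k then 1 else 0
    | zero, blue f, zero, blue k => if f = k then x else 0
    | blue j, plus, blue i, plus => if j = i then 1 else 0
    | blue j, blue f, zero, zero => if j = f then 1 else 0
    | bluePlus j, blue f, zero, plus => if j = f then 1 else 0
    | blue j, blue f, blue i, blue k =>
        (if i = k ∧ j = f ∧ i ≤ f then 1 else 0) + if f = k ∧ j = i ∧ σ f < σ i then 1 else 0
    | bluePlus j, blue f, bluePlus i, blue k =>
        (if i = k ∧ j = f ∧ i ≤ f then 1 else 0) + if f = k ∧ j = i ∧ σ f < σ i then 1 else 0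
    | _, _, _, _ => 0 := by
  unfold rightWeight
  split <;> grind [RightTrivial, RightNontrivial]

/-- The sum of `V t` over the right-sheared tiles with left, bottom and right labels `l`, `b`, `r`,
weighted by the tiles, where `t` is the top label; see `sum_rightWeight_mul`. -/
def topSum (l b r : Label n) (V : Label n → R) : R :=
  match l, b, r with
  | zero, zero, zero => V zero
  | zero, zero, blue i => V (blue i)
  | zero, plus, zero => V plus
  | zero, plus, bluePlus i => V (blue i)
  | zero, blue f, zero => x * V (blue f)
  | blue j, plus, blue i => if j = i then V plus else 0
  | blue j, blue f, zero => if j = f then V zero else 0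
  | bluePlus j, blue f, zero => if j = f then V plus else 0
  | blue j, blue f, blue i =>
    (if j = f then if i ≤ f then V (blue i) else 0 else 0) +
      if j = i then if σ f < σ i then V (blue f) else 0 else 0
  | bluePlus j, blue f, bluePlus i =>
    (if j = f then if i ≤ f then V (blue i) else 0 else 0) +
      if j = i then if σ f < σ i then V (blue f) else 0 else 0
  | _, _, _ => 0

theorem sum_rightWeight_mul (l b r : Label n) (V : Label n → R) :
    ∑ t, rightWeight σ x l b r t * V t = topSum σ x l b r V := by
  cases l <;> cases b <;> cases r <;>
    simp [sum_univ, rightWeight_eq, topSum, ite_and, add_mul, Finset.sum_add_distrib]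

/-- The sum of `V r t` over the right-sheared tiles with left and bottom labels `l`, `b`, weighted
by the tiles, where `r` and `t` are the right and top labels; see `sum_topSum`. -/
def rightTopSum (l b : Label n) (V : Label n → Label n → R) : R :=
  match l, b with
  | zero, zero => V zero zero + ∑ i, V (blue i) (blue i)
  | zero, plus => V zero plus + ∑ i, V (bluePlus i) (blue i)
  | zero, blue f => x * V zero (blue f)
  | blue j, plus => V (blue j) plus
  | blue j, blue f =>
    (if j = f then V zero zero + ∑ i ∈ Finset.Iic j, V (blue i) (blue i) else 0) +
      if σ f < σ j then V (blue j) (blue f) else 0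
  | bluePlus j, blue f =>
    (if j = f then V zero plus + ∑ i ∈ Finset.Iic j, V (bluePlus i) (blue i) else 0) +
      if σ f < σ j then V (bluePlus j) (blue f) else 0
  | _, _ => 0

theorem sum_topSum (l b : Label n) (V : Label n → Label n → R) :
    ∑ r, topSum σ x l b r (V r) = rightTopSum σ x l b V := by
  have sum_Iic_eq (j : Fin n) (G : Fin n → R) :
      ∑ i ∈ Finset.Iic j, G i = ∑ i, if i ≤ j then G i else 0 := by
    simp [← Finset.sum_filter, ← Finset.filter_ge_eq_Iic]
  cases l <;> cases b <;>
    simp only [sum_univ, topSum, rightTopSum, Finset.sum_add_distrib, sum_Iic_eq, Finset.sum_ite_eq,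
      Finset.sum_ite_irrel, Finset.sum_const_zero, Finset.mem_univ, ↓reduceIte, add_zero, zero_add]
  all_goals grind

theorem leftWeight_eq (l b r t : Label n) : leftWeight x l b r t =
    match l, b, r, t with
    | zero, zero, zero, zero => 1
    | zero, blue i, zero, blue j => if i = j then 1 else 0
    | zero, plus, plus, zero => 1
    | zero, plus, bluePlus i, blue j => if i = j then 1 else 0
    | zero, plus, zero, plus => -x
    | plus, zero, zero, plus => 1
    | plus, blue i, plus, blue j => if i = j then 1 else 0
    | plus, plus, plus, plus => 1
    | bluePlus i, blue j, zero, plus => if i = j then 1 else 0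
    | _, _, _, _ => 0 := by
  unfold leftWeight
  split <;> grind [LeftTrivial, LeftNontrivial]

theorem leftWeight_rotate (l b r t : Label n) : leftWeight x l b r t = leftWeight x r t l b := by
  unfold leftWeight
  grind [LeftTrivial, LeftNontrivial]

/-- The sum of `V r t` over the left-sheared tiles with left and bottom labels `l`, `b`, weighted
by the tiles, where `r` and `t` are the right and top labels; see `sum_leftWeight_mul`. -/
def leftSum (l b : Label n) (V : Label n → Label n → R) : R :=
  match l, b with
  | zero, zero => V zero zero
  | zero, blue i => V zero (blue i)
  | zero, plus => V plus zero + ∑ i, V (bluePlus i) (blue i) - x * V zero plus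
  | plus, zero => V zero plus
  | plus, blue i => V plus (blue i)
  | plus, plus => V plus plus
  | bluePlus i, blue j => if i = j then V zero plus else 0
  | _, _ => 0

theorem sum_leftWeight_mul (l b : Label n) (V : Label n → Label n → R) :
    ∑ r, ∑ t, leftWeight x l b r t * V r t = leftSum x l b V := by
  cases l <;> cases b <;>
    simp only [leftWeight_eq, leftSum, sum_univ, Finset.sum_ite_eq, Finset.sum_const_zero,
      Finset.mem_univ, ↓reduceIte, ite_mul, neg_mul, one_mul, zero_mul, add_zero, zero_add]
  grind

/-- The transfer matrix of a row of two adjacent right-sheared tiles with parameters `x` and `y`,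
left label `q` and right label `t`; the indices are the pairs of bottom and of top labels. -/
noncomputable def twoColumns (q t : Label n) : Matrix (Label n × Label n) (Label n × Label n) R :=
  fun a a' => ∑ w, rightWeight σ x q a.1 w a'.1 * rightWeight σ y w a.2 t a'.2

theorem twoColumns_mulVec (q t : Label n) (F : Label n × Label n → R) (a b : Label n) :
    (twoColumns σ x y q t *ᵥ F) (a, b) =
      rightTopSum σ x q a fun w a' => topSum σ y w b t fun b' => F (a', b') := by
  simp only [← sum_rightWeight_mul, ← sum_topSum, mulVec, dotProduct, twoColumns, Finset.sum_mul,
    Fintype.sum_prod_type, Finset.mul_sum, mul_assoc]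
  conv_rhs => rw [Finset.sum_comm]
  exact Finset.sum_congr rfl fun _ _ => Finset.sum_comm

theorem twoColumns_mulVec_blue (j l f k : Fin n) (F : Label n × Label n → R) :
    (twoColumns σ x y (blue j) (blue l) *ᵥ F) (blue f, blue k) =
      colourExchange σ (fun k l => colourExchange σ
        (fun f k => if j = f then F (blue k, blue l) else 0) f k) k l := by
  simp only [twoColumns_mulVec, rightTopSum, topSum, colourExchange, Finset.sum_add_distrib,
    Finset.sum_ite_eq', Finset.mem_Iic, zero_add]
  grind

theorem twoColumns_mulVec_bluePlus (j l f k : Fin n) (F : Label n × Label n → R) :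
    (twoColumns σ x y (bluePlus j) (bluePlus l) *ᵥ F) (blue f, blue k) =
      colourExchange σ (fun k l => colourExchange σ
        (fun f k => if j = f then F (blue k, blue l) else 0) f k) k l := by
  simp only [twoColumns_mulVec, rightTopSum, topSum, colourExchange, Finset.sum_add_distrib,
    Finset.sum_ite_eq', Finset.mem_Iic, zero_add]
  grind

/-- The operator on functions of two adjacent horizontal edges which intertwines the two orders of
the parameters `x` and `0` in `twoColumns`: the lines on the two edges may change places, with
weight `x` unless both of them are blue. -/
def exchange (F : Label n × Label n → R) : Label n × Label n → R
  | (zero, plus) => F (zero, plus) + x * F (plus, zero)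
  | (blue f, zero) => F (blue f, zero) + x * F (zero, blue f)
  | (blue f, plus) => F (blue f, plus) + x * F (plus, blue f)
  | (blue f, blue k) => colourExchange σ (fun f k => F (blue f, blue k)) f k
  | p => F p

theorem twoColumns_mulVec_exchange (q t : Label n) (F : Label n × Label n → R) :
    twoColumns σ x 0 q t *ᵥ exchange σ x F = exchange σ x (twoColumns σ 0 x q t *ᵥ F) := by
  ext ⟨a, b⟩
  rcases q <;> rcases t <;> rcases a <;> rcases b
  -- Only in these two cases do three blue lines meet.
  case blue.blue.blue.blue j l f k =>
    simp only [exchange, twoColumns_mulVec_blue, ← colourExchange_ite]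
    exact (colourExchange_braid σ (fun f k l => if j = f then F (blue k, blue l) else 0) f k l).symm
  case bluePlus.bluePlus.blue.blue j l f k =>
    simp only [exchange, twoColumns_mulVec_bluePlus, ← colourExchange_ite]
    exact (colourExchange_braid σ (fun f k l => if j = f then F (blue k, blue l) else 0) f k l).symm
  all_goals
    simp only [twoColumns_mulVec, rightTopSum, topSum, exchange, colourExchange,
      Finset.sum_add_distrib, Finset.sum_ite_eq', Finset.sum_const_zero, Finset.mem_univ,
      Finset.mem_Iic, ↓reduceIte, ite_self, mul_ite, mul_zero, zero_mul, add_zero, zero_add]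
  all_goals grind

/-- The indicator of `Triangle`. -/
noncomputable def triangleWeight (R : Type*) [CommRing R] (σ : Equiv.Perm (Fin n))
    (a h d : Label n) : R :=
  open Classical in if Triangle σ a h d then 1 else 0

theorem triangleWeight_eq (a h d : Label n) : triangleWeight R σ a h d =
    match a, h, d with
    | zero, zero, zero => 1
    | zero, plus, plus => 1
    | blue i, blue j, zero => if i = j then 1 else 0
    | blue i, plus, bluePlus j => if i = j then 1 else 0
    | bluePlus i, blue j, plus => if i = j then 1 else 0
    | blue g, blue f, cross f' g' => if f = f' ∧ g = g' ∧ σ f < σ g then 1 else 0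
    | bluePlus g, blue f, crossPlus f' g' => if f = f' ∧ g = g' ∧ σ f < σ g then 1 else 0
    | _, _, _ => 0 := by
  unfold triangleWeight
  split <;> grind [Triangle]

theorem triangleWeight_zero (a h : Label n) :
    triangleWeight R σ a h zero = rightWeight σ 0 zero zero a h := by
  unfold triangleWeight rightWeight
  grind [Triangle, RightTrivial]

theorem triangleWeight_plus (a h : Label n) :
    triangleWeight R σ a h plus = rightWeight σ 0 zero plus a h := by
  unfold triangleWeight rightWeight
  grind [Triangle, RightTrivial]

theorem triangleWeight_bluePlus (a h : Label n) (i : Fin n) :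
    triangleWeight R σ a h (bluePlus i) = rightWeight σ 0 (blue i) plus a h := by
  unfold triangleWeight rightWeight
  grind [Triangle, RightTrivial]

theorem sum_triangleWeight_mul (a h : Label n) (V : Label n → R) :
    ∑ d, triangleWeight R σ a h d * V d = match a, h with
    | zero, zero => V zero
    | zero, plus => V plus
    | blue i, plus => V (bluePlus i)
    | blue g, blue f => (if f = g then V zero else 0) + if σ f < σ g then V (cross f g) else 0
    | bluePlus g, blue f =>
      (if f = g then V plus else 0) + if σ f < σ g then V (crossPlus f g) else 0
    | _, _ => 0 := by
  cases a <;> cases h <;>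
    simp only [sum_univ, triangleWeight_eq, ite_and, Finset.sum_ite_eq, Finset.sum_ite_irrel,
      Finset.sum_const_zero, Finset.mem_univ, ↓reduceIte, ite_mul, one_mul, zero_mul, add_zero,
      zero_add]
  all_goals grind

/-- `0` if the adjacency of two diamonds with these labels is banned and `1` otherwise. -/
noncomputable def adjacencyWeight (R : Type*) [CommRing R] (nw e se : Label n) : R :=
  open Classical in if ¬ Banned nw e se then 1 else 0

theorem rightWeight_zero_eq_sum_triangleWeight (l b r t : Label n) :
    rightWeight σ 0 l b r t =
      ∑ e, triangleWeight R σ l b e * triangleWeight R σ r t e * adjacencyWeight R l e r := by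
  simp only [mul_assoc, sum_triangleWeight_mul]
  split <;> rcases r <;> rcases t <;>
    simp only [triangleWeight_eq, rightWeight_eq, ite_mul, ite_self, one_mul, zero_mul, add_zero]
  all_goals grind [Banned, adjacencyWeight]

/-- The part of the left-hand side below its two columns: the left-sheared tile and the lower half
of the first diamond. The arguments are their two top edges. -/
noncomputable def lowerEndLHS (r s t : Label n) (p : Label n × Label n) : R :=
  ∑ e, leftWeight x r s e p.1 * triangleWeight R σ t p.2 e

/-- The part of the left-hand side above its two columns: the last right-sheared tile and the upper
half of the last diamond. The arguments are their two bottom edges. -/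
noncomputable def upperEndLHS (q u v : Label n) (p : Label n × Label n) : R :=
  ∑ w, rightWeight σ x q p.1 w v * triangleWeight R σ w p.2 u

/-- The part of the right-hand side below its two columns: the lower half of the first diamond and
the first right-sheared tile. The arguments are their two top edges. -/
noncomputable def lowerEndRHS (r s t : Label n) (p : Label n × Label n) : R :=
  ∑ w, triangleWeight R σ w p.1 r * rightWeight σ x w s t p.2

/-- The part of the right-hand side above its two columns: the upper half of the last diamond and
the left-sheared tile. The arguments are their two bottom edges. -/
noncomputable def upperEndRHS (q u v : Label n) (p : Label n × Label n) : R :=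
  ∑ e, triangleWeight R σ q p.1 e * leftWeight x e p.2 u v

theorem lowerEndLHS_dotProduct (r s t : Label n) (F : Label n × Label n → R) :
    lowerEndLHS σ x r s t ⬝ᵥ F =
      leftSum x r s fun e h => ∑ m, triangleWeight R σ t m e * F (h, m) := by
  simp only [← sum_leftWeight_mul, lowerEndLHS, dotProduct, Fintype.sum_prod_type, Finset.mul_sum,
    Finset.sum_mul, mul_assoc]
  conv_rhs => rw [Finset.sum_comm]
  exact Finset.sum_congr rfl fun _ _ => Finset.sum_comm

theorem lowerEndRHS_dotProduct {r : Label n} (hr : r = zero ∨ r = plus) (s t : Label n)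
    (F : Label n × Label n → R) :
    lowerEndRHS σ x r s t ⬝ᵥ F =
      rightTopSum σ 0 zero r fun w m => topSum σ x w s t fun h => F (m, h) := by
  have half_eq (w m : Label n) : triangleWeight R σ w m r = rightWeight σ 0 zero r w m := by
    rcases hr with rfl | rfl
    exacts [triangleWeight_zero σ w m, triangleWeight_plus σ w m]
  simp only [← sum_topSum, ← sum_rightWeight_mul, lowerEndRHS, half_eq, dotProduct,
    Fintype.sum_prod_type, Finset.mul_sum, Finset.sum_mul, mul_assoc]
  conv_rhs => rw [Finset.sum_comm]
  exact Finset.sum_congr rfl fun _ _ => Finset.sum_comm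

theorem upperEndLHS_eq (q u v : Label n) (p : Label n × Label n) :
    upperEndLHS σ x q u v p =
      rightTopSum σ x q p.1 fun w h => if h = v then triangleWeight R σ w p.2 u else 0 := by
  simp [← sum_topSum, ← sum_rightWeight_mul, upperEndLHS]

theorem upperEndRHS_eq (q u v : Label n) (p : Label n × Label n) :
    upperEndRHS σ x q u v p =
      leftSum x u v fun e h => if h = p.2 then triangleWeight R σ q p.1 e else 0 := by
  simp [← sum_leftWeight_mul, upperEndRHS, leftWeight_rotate x u v, mul_comm]

theorem lowerEndLHS_dotProduct_exchange {r : Label n} (hr : r = zero ∨ r = plus) (s t : Label n)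
    (F : Label n × Label n → R) :
    lowerEndLHS σ x r s t ⬝ᵥ exchange σ x F = lowerEndRHS σ x r s t ⬝ᵥ F := by
  rw [lowerEndLHS_dotProduct, lowerEndRHS_dotProduct σ x hr]
  rcases hr with rfl | rfl <;> rcases s <;>
    simp only [leftSum, rightTopSum, triangleWeight_zero, triangleWeight_plus,
      triangleWeight_bluePlus, sum_rightWeight_mul] <;>
    rcases t <;>
      simp only [topSum, exchange, Finset.sum_add_distrib, Finset.sum_ite_eq',
        Finset.sum_const_zero, Finset.mem_univ, ↓reduceIte, add_sub_cancel_right, sub_self,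
        sub_zero, mul_zero, add_zero, zero_add]
  all_goals grind [colourExchange]

theorem upperEndLHS_eq_exchange {u : Label n} (hu : u = zero ∨ u = plus) (q v : Label n) :
    upperEndLHS σ x q u v = exchange σ x (upperEndRHS σ x q u v) := by
  ext ⟨a, b⟩
  rw [upperEndLHS_eq, funext (upperEndRHS_eq σ x q u v)]
  rcases hu with rfl | rfl <;> rcases v <;> simp only [leftSum] <;>
    rcases q <;> rcases a <;> rcases b <;>
      simp only [rightTopSum, triangleWeight_eq, exchange, blue.injEq, reduceCtorEq, ↓reduceIte,
        Finset.sum_ite_eq', Finset.sum_const_zero, Finset.mem_univ, Finset.mem_Iic, ite_self,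
        mul_ite, mul_one, mul_zero, sub_self, sub_zero, zero_sub, neg_add_cancel, add_zero,
        zero_add]
  all_goals grind [colourExchange]

end Tiles

section Columns

variable {n k : ℕ} {R : Type*} [CommRing R] (σ : Equiv.Perm (Fin n)) (x y : R)

theorem sum_twoColumns_path (q t : Fin k → Label n) (f g : Label n × Label n → R) :
    ∑ a : Fin (k + 1) → Label n, ∑ b : Fin (k + 1) → Label n, ∑ w : Fin k → Label n,
      f (a 0, b 0) * ((∏ i, rightWeight σ x (q i) (a i.castSucc) (w i) (a i.succ)) *
        ∏ i, rightWeight σ y (w i) (b i.castSucc) (t i) (b i.succ)) *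
        g (a (Fin.last k), b (Fin.last k)) =
      f ⬝ᵥ (List.ofFn fun i => twoColumns σ x y (q i) (t i)).prod *ᵥ g := by
  simp only [← sum_path_eq_dotProduct, twoColumns, Fintype.prod_sum, Finset.prod_mul_distrib,
    Finset.mul_sum, Finset.sum_mul]
  rw [← (Equiv.arrowProdEquivProdArrow _ _ _).symm.sum_comp, Fintype.sum_prod_type]
  rfl

theorem Triangle.horizontal_unique {σ : Equiv.Perm (Fin n)} {a h h' d : Label n}
    (hh : Triangle σ a h d) (hh' : Triangle σ a h' d) : h = h' := by
  cases hh <;> cases hh' <;> rfl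

theorem sum_triangleWeight_mul_triangleWeight (sw se nw ne : Label n) :
    ∑ h, triangleWeight R σ nw h ne * triangleWeight R σ se h sw =
      open Classical in if Diamond σ sw se nw ne then 1 else 0 := by
  classical
  simp only [triangleWeight, ite_zero_mul_ite_zero, mul_one]
  split_ifs with diamond
  · obtain ⟨h₀, upper, lower⟩ := diamond
    rw [Fintype.sum_eq_single h₀ fun h ne_h₀ =>
      if_neg fun tri => ne_h₀ (tri.1.horizontal_unique upper)]
    exact if_pos ⟨upper, lower⟩
  · exact Finset.sum_eq_zero fun h _ => if_neg fun tri => diamond ⟨h, tri⟩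

theorem stripWeight_succ (e : Fin (k + 2) → Label n) (se nw : Fin (k + 1) → Label n) :
    stripWeight R σ e se nw =
      ∑ h : Fin (k + 1) → Label n, (∏ i, triangleWeight R σ (nw i) (h i) (e i.succ) *
          triangleWeight R σ (se i) (h i) (e i.castSucc)) *
        ∏ i : Fin k, adjacencyWeight R (nw i.castSucc) (e i.castSucc.succ) (se i.succ) := by
  classical
  have consecutive : (∀ i j : Fin (k + 1), (j : ℕ) = i + 1 → ¬ Banned (nw i) (e i.succ) (se j)) ↔
      ∀ i : Fin k, ¬ Banned (nw i.castSucc) (e i.castSucc.succ) (se i.succ) := by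
    refine ⟨fun h i => h _ _ (by simp), fun h i j hij => ?_⟩
    obtain ⟨i, rfl⟩ := Fin.exists_castSucc_eq.2 (fun hi : i = Fin.last k => by grind)
    obtain rfl : j = i.succ := Fin.ext hij
    exact h i
  rw [← Finset.sum_mul, ← Fintype.prod_sum fun i h =>
    triangleWeight R σ (nw i) h (e i.succ) * triangleWeight R σ (se i) h (e i.castSucc)]
  simp only [sum_triangleWeight_mul_triangleWeight, adjacencyWeight, Finset.prod_boole,
    stripWeight, DiamondStrip, consecutive, ite_zero_mul_ite_zero, mul_one,
    Finset.mem_univ, true_imp_iff]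

theorem sum_stripWeight (F G : Label n → R) (se nw : Fin (k + 1) → Label n) :
    ∑ e, F (e 0) * stripWeight R σ e se nw * G (e (Fin.last _)) =
      ∑ h : Fin (k + 1) → Label n, (∑ a, F a * triangleWeight R σ (se 0) (h 0) a) *
        (∏ i : Fin k, rightWeight σ 0 (nw i.castSucc) (h i.castSucc) (se i.succ) (h i.succ)) *
        ∑ a, triangleWeight R σ (nw (Fin.last k)) (h (Fin.last k)) a * G a := by
  conv_lhs =>
    simp only [stripWeight_succ, Finset.mul_sum, Finset.sum_mul]
    rw [Finset.sum_comm]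
  refine Finset.sum_congr rfl fun h _ => ?_
  simp only [rightWeight_zero_eq_sum_triangleWeight]
  rw [← sum_mul_prod_mul_eq_mul_prod_mul]
  refine Finset.sum_congr rfl fun e _ => ?_
  simp only [Finset.prod_mul_distrib]
  rw [Fin.prod_univ_castSucc fun i => triangleWeight R σ (nw i) (h i) (e i.succ),
    Fin.prod_univ_succ fun i => triangleWeight R σ (se i) (h i) (e i.castSucc)]
  simp only [Fin.succ_castSucc, Fin.succ_last, Fin.castSucc_zero]
  ring

theorem columnLHS_zero (q t : Fin 0 → Label n) (r s u v : Label n) :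
    columnLHS σ x q r s t u v = leftWeight x r s u v := by
  simp [columnLHS, stripWeight, DiamondStrip, sum_fin_cons, ite_and]

theorem columnRHS_zero (q t : Fin 0 → Label n) (r s u v : Label n) :
    columnRHS σ x q r s t u v = leftWeight x r s u v := by
  simp [columnRHS, stripWeight, DiamondStrip, sum_fin_cons, ite_and]

theorem columnLHS_succ_eq_sum (q t : Fin (k + 1) → Label n) (r s u v : Label n) :
    columnLHS σ x q r s t u v =
      ∑ a : Fin (k + 1) → Label n, ∑ w : Fin k → Label n, ∑ w',
        (∏ i : Fin k, rightWeight σ x (q i.castSucc) (a i.castSucc) (w i) (a i.succ)) *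
        rightWeight σ x (q (Fin.last k)) (a (Fin.last k)) w' v *
        ∑ e : Fin (k + 2) → Label n, leftWeight x r s (e 0) (a 0) *
          stripWeight R σ e t (Fin.snoc w w') * if e (Fin.last _) = u then 1 else 0 := by
  unfold columnLHS
  rw [sum_fin_snoc]
  refine Finset.sum_congr rfl fun a _ => ?_
  rw [Fintype.sum_eq_single v fun h' hv => by simp [hv], Finset.sum_comm, sum_fin_snoc]
  refine Finset.sum_congr rfl fun w _ => Finset.sum_congr rfl fun w' _ => ?_
  rw [Finset.mul_sum]
  refine Finset.sum_congr rfl fun e _ => ?_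
  simp only [Fin.prod_univ_castSucc (n := k), Fin.snoc_castSucc, Fin.snoc_last,
    Fin.succ_castSucc, Fin.succ_last, Fin.snoc_apply_zero, true_and]
  split_ifs <;> ring

theorem columnLHS_succ (q t : Fin (k + 1) → Label n) (r s u v : Label n) :
    columnLHS σ x q r s t u v =
      lowerEndLHS σ x r s (t 0) ⬝ᵥ
        (List.ofFn fun i : Fin k => twoColumns σ x 0 (q i.castSucc) (t i.succ)).prod *ᵥ
          upperEndLHS σ x (q (Fin.last k)) u v := by
  rw [columnLHS_succ_eq_sum, ← sum_twoColumns_path]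
  calc _
    _ = ∑ a : Fin (k + 1) → Label n, ∑ w : Fin k → Label n, ∑ w',
          (∏ i : Fin k, rightWeight σ x (q i.castSucc) (a i.castSucc) (w i) (a i.succ)) *
          rightWeight σ x (q (Fin.last k)) (a (Fin.last k)) w' v *
          ∑ b : Fin (k + 1) → Label n,
            lowerEndLHS σ x r s (t 0) (a 0, b 0) *
            (∏ i, rightWeight σ 0 (w i) (b i.castSucc) (t i.succ) (b i.succ)) *
            triangleWeight R σ w' (b (Fin.last k)) u := by
        refine Finset.sum_congr rfl fun a _ => Finset.sum_congr rfl fun w _ =>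
          Finset.sum_congr rfl fun w' _ => congrArg (HMul.hMul _) ?_
        simpa [lowerEndLHS] using sum_stripWeight σ (fun e => leftWeight x r s e (a 0))
          (fun e => if e = u then 1 else 0) t (Fin.snoc w w')
    _ = _ := by
        simp only [upperEndLHS, Finset.mul_sum]
        refine Finset.sum_congr rfl fun a _ => ?_
        conv_rhs => rw [Finset.sum_comm]
        refine Finset.sum_congr rfl fun w _ => ?_
        rw [Finset.sum_comm]
        refine Finset.sum_congr rfl fun b _ => Finset.sum_congr rfl fun w' _ => ?_
        ring

theorem columnRHS_succ_eq_sum (q t : Fin (k + 1) → Label n) (r s u v : Label n) :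
    columnRHS σ x q r s t u v =
      ∑ b : Fin (k + 1) → Label n, ∑ w : Fin k → Label n, ∑ w',
        rightWeight σ x w' s (t 0) (b 0) *
        (∏ i : Fin k, rightWeight σ x (w i) (b i.castSucc) (t i.succ) (b i.succ)) *
        ∑ e : Fin (k + 2) → Label n, (if e 0 = r then 1 else 0) *
          stripWeight R σ e (Fin.cons w' w) q *
            leftWeight x (e (Fin.last _)) (b (Fin.last k)) u v := by
  unfold columnRHS
  rw [sum_fin_cons]
  refine Finset.sum_congr rfl fun b _ => ?_
  rw [Fintype.sum_eq_single s fun h' hs => by simp [hs], Finset.sum_comm, sum_fin_cons]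
  refine Finset.sum_congr rfl fun w _ => Finset.sum_congr rfl fun w' _ => ?_
  rw [Finset.mul_sum]
  refine Finset.sum_congr rfl fun e _ => ?_
  simp only [Fin.prod_univ_succ (n := k), Fin.cons_zero, Fin.cons_succ, ← Fin.succ_castSucc,
    ← Fin.succ_last, Fin.castSucc_zero, true_and]
  split_ifs <;> ring

theorem columnRHS_succ (q t : Fin (k + 1) → Label n) (r s u v : Label n) :
    columnRHS σ x q r s t u v =
      lowerEndRHS σ x r s (t 0) ⬝ᵥ
        (List.ofFn fun i : Fin k => twoColumns σ 0 x (q i.castSucc) (t i.succ)).prod *ᵥ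
          upperEndRHS σ x (q (Fin.last k)) u v := by
  rw [columnRHS_succ_eq_sum, ← sum_twoColumns_path]
  calc _
    _ = ∑ b : Fin (k + 1) → Label n, ∑ w : Fin k → Label n, ∑ w',
          rightWeight σ x w' s (t 0) (b 0) *
          (∏ i : Fin k, rightWeight σ x (w i) (b i.castSucc) (t i.succ) (b i.succ)) *
          ∑ a : Fin (k + 1) → Label n, triangleWeight R σ w' (a 0) r *
            (∏ i, rightWeight σ 0 (q i.castSucc) (a i.castSucc) (w i) (a i.succ)) *
            upperEndRHS σ x (q (Fin.last k)) u v (a (Fin.last k), b (Fin.last k)) := by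
        refine Finset.sum_congr rfl fun b _ => Finset.sum_congr rfl fun w _ =>
          Finset.sum_congr rfl fun w' _ => congrArg (HMul.hMul _) ?_
        simpa [upperEndRHS] using sum_stripWeight σ (fun e => if e = r then 1 else 0)
          (fun e => leftWeight x e (b (Fin.last k)) u v) (Fin.cons w' w) q
    _ = _ := by
        simp only [lowerEndRHS, Finset.mul_sum, Finset.sum_mul]
        conv_rhs => rw [Finset.sum_comm]
        refine Finset.sum_congr rfl fun b _ => ?_
        conv_rhs => rw [Finset.sum_comm]
        refine Finset.sum_congr rfl fun w _ => ?_
        rw [Finset.sum_comm]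
        refine Finset.sum_congr rfl fun a _ => Finset.sum_congr rfl fun w' _ => ?_
        ring

end Columns

end Label

theorem mainTheorem2 {n m : ℕ} {R : Type*} [CommRing R] (σ : Equiv.Perm (Fin n)) (x : R)
    (q : Fin m → Label n) (r s : Label n) (t : Fin m → Label n) (u v : Label n)
    (hr : r = Label.zero ∨ r = Label.plus) (hu : u = Label.zero ∨ u = Label.plus) :
    columnLHS σ x q r s t u v = columnRHS σ x q r s t u v := by
  cases m with
  | zero => rw [Label.columnLHS_zero, Label.columnRHS_zero]
  | succ k =>
    rw [Label.columnLHS_succ, Label.columnRHS_succ, Label.upperEndLHS_eq_exchange σ x hu,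
      list_prod_mulVec_comm _ _ _ fun i => Label.twoColumns_mulVec_exchange σ x _ _,
      Label.lowerEndLHS_dotProduct_exchange σ x hr]
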